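/- Let $d\ge 3$. For $R>0$ let $\mathbf B_R\subset\mathbb R^d$ be the open Euclidean ball of radius $R$ centred at the origin, $\overline{\mathbf B}_R$ its closure, and $\mathcal B_R=\mathbf B_R\cap\mathbb Z^d$. For a closed set $T\subset S^{d-1}=\{x\in\mathbb R^d:\|x\|_2=1\}$ let $K(T)=\{x\in\mathbb R^d: x\neq 0,\ x/\|x\|_2\in T\}$ be the infinite cone determined by $T$ and the origin. There is a finite constant $R_1=R_1(d)$ such that for all $\delta,c_p>1$ there is a finite constant $C'=C'(d,\delta,c_p)$ for which the following holds. Let $R>1$ with $R>R_1$, put $R^+=R+\delta\sqrt{\log R}$, let $T\subset S^{d-1}$ be closed with $\|x-y\|_2\le c_p/R$ for all $x,y\in T$, and let $\mathcal C=(\overline{\mathbf B}_{R^+}\setminus\mathbf B_R)\cap K(T)\cap\mathbb Z^d$ be the discrete cell determined by the annulus $\overline{\mathbf B}_{R^+}\setminus\mathbf B_R$ and $T$. If $Y=(Y_n)_{n\ge 0}$ is a simple random walk on $\mathbb Z^d$ started at the origin, then $$\mathbb P_{\mathbf 0}\bigl(Y\text{ hits }\mathcal C\text{ before }\mathcal B_{R^+}^c\bigr)\le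 C'\,\frac{\log R}{R^{d-1}},$$ where the event means that there is a time $k\ge 0$ with $Y_k\in\mathcal C$ and $Y_j\in\mathcal B_{R^+}$ for all $j<k$ (so a first exit from $\mathcal B_{R^+}$ at a point of $\mathcal C$ is counted as well). -/

import Mathlib

open MeasureTheory ProbabilityTheory

noncomputable section

namespace SRWCell

/-- The point of the Euclidean space `ℝ^d` that corresponds to a vertex of `ℤ^d`. -/
def toEuclid {d : ℕ} (x : Fin d → ℤ) : EuclideanSpace ℝ (Fin d) :=
  WithLp.toLp 2 (fun i => (x i : ℝ))

/-- The infinite cone `K(T) = {x : x / ‖x‖ ∈ T}`; for `T` in the unit sphere it does not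
contain the origin. -/
def cone {d : ℕ} (T : Set (EuclideanSpace ℝ (Fin d))) : Set (EuclideanSpace ℝ (Fin d)) :=
  {x | ‖x‖⁻¹ • x ∈ T}

/-- The annulus `A(R, R')`: the closed ball of (outer) radius `R` minus the open ball of (inner)
radius `R'`, both centred at the origin. -/
def annulus (d : ℕ) (R R' : ℝ) : Set (EuclideanSpace ℝ (Fin d)) :=
  Metric.closedBall 0 R \ Metric.ball 0 R'

/-- The cell `C(A, T) = A ∩ K(T)`. -/
def cell {d : ℕ} (A T : Set (EuclideanSpace ℝ (Fin d))) : Set (EuclideanSpace ℝ (Fin d)) :=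
  A ∩ cone T

/-- The trace `S ∩ ℤ^d` on the lattice of a subset `S` of `ℝ^d`. -/
def lattice {d : ℕ} (S : Set (EuclideanSpace ℝ (Fin d))) : Set (Fin d → ℤ) :=
  {x | toEuclid x ∈ S}

/-- The lattice ball `B_R`: the lattice points of the open Euclidean ball of radius `R` centred
at the origin. -/
def latticeBall (d : ℕ) (R : ℝ) : Set (Fin d → ℤ) :=
  lattice (Metric.ball (0 : EuclideanSpace ℝ (Fin d)) R)

/-- Under the measure `μ`, the process `Y` is a (discrete time, nearest neighbour) simple random
walk on `ℤ^d` started at `v`: its increments are independent, and each of them is uniformly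
distributed on the `2 d` unit vectors `± e_i`. -/
structure IsSimpleRandomWalk {Ω : Type*} [MeasurableSpace Ω] (μ : Measure Ω) {d : ℕ}
    (v : Fin d → ℤ) (Y : ℕ → Ω → (Fin d → ℤ)) : Prop where
  measurable : ∀ n, Measurable (Y n)
  start : ∀ᵐ ω ∂μ, Y 0 ω = v
  indep : iIndepFun (fun n ω => Y (n + 1) ω - Y n ω) μ
  step_pos : ∀ (n : ℕ) (i : Fin d),
    μ.real {ω | Y (n + 1) ω - Y n ω = Pi.single i 1} = 1 / (2 * (d : ℝ))
  step_neg : ∀ (n : ℕ) (i : Fin d),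
    μ.real {ω | Y (n + 1) ω - Y n ω = -Pi.single i 1} = 1 / (2 * (d : ℝ))

/-- The trajectory `y` hits `A` before `B`: it visits `A` at some time `k` and has not visited `B`
at any earlier time. When `A` and `B` meet, a simultaneous first visit to both of them, at a
common point, is counted as well. -/
def HitsBefore {α : Type*} (y : ℕ → α) (A B : Set α) : Prop :=
  ∃ k, y k ∈ A ∧ ∀ j < k, y j ∉ B

end SRWCell

end

/-! By a union bound, the hitting probability is at most the number of points in the cell times the
largest expected number of visits to one of them before the walk leaves the ball. The cell has
bounded angular diameter times radius, so it holds `O(√(log R))` points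
(`exists_finset_eq_lattice_cell`).

The visits are bounded without Green function asymptotics. The function `F x = (|x|² + b) ^ (-(d -
2) / 2)`, a regularised `|x| ^ (2 - d)`, is strictly superharmonic on all of `ℤ^d` for large `b`
(`exists_potential_superharmonic`). A multiple of `F - m`, with `m` the value of `F` at radius `ρ +
1`, therefore dominates the Green function killed outside radius `ρ` (`sum_le_of_superharmonic`).
For `ρ = R + δ√(log R)` and `|x| ≥ R`, convexity bounds `F x - m` by `O(√(log R) / R ^ (d - 1))`.
The two factors `√(log R)` give the `log R`. -/

namespace SRWCell

/-! ### A strictly superharmonic function on the lattice -/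

/-- The second-order Taylor expansion of `t ↦ (1 + t) ^ (-a) + (1 - t) ^ (-a)` at `0`. -/
lemma exists_rpow_add_rpow_le (a : ℝ) :
    ∃ K ε : ℝ, 0 ≤ K ∧ 0 < ε ∧ ∀ t : ℝ, |t| < ε →
      (1 + t) ^ (-a) + (1 - t) ^ (-a) ≤ 2 + a * (a + 1) * t ^ 2 + K * t ^ 4 := by
  -- Expand to third order at `t` and at `-t`: odd terms cancel in the sum, and the two remainders
  -- add up to `2 * c * t ^ 4`.
  have h := (Real.one_add_rpow_hasFPowerSeriesAt_zero (a := -a)).isBigO_sub_partialSum_pow 4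
  obtain ⟨c, hc, hb⟩ := h.exists_pos
  obtain ⟨ε, hε, hball⟩ := Metric.eventually_nhds_iff.1 hb.bound
  refine ⟨2 * c, ε, by positivity, hε, fun t ht => ?_⟩
  have h1 := hball (y := t) (by simpa using ht)
  have h2 := hball (y := -t) (by simpa using ht)
  have hs : (Ring.choose (-a) 2 : ℝ) = a * (a + 1) / 2 := by
    have := Ring.descPochhammer_eq_factorial_smul_choose (-a) 2
    simp [descPochhammer_succ_right, Polynomial.smeval_mul, Polynomial.smeval_sub,
      Nat.factorial] at this
    linarith
  simp only [FormalMultilinearSeries.partialSum, Finset.sum_range_succ, Finset.sum_range_zero,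
    binomialSeries_apply, Ring.choose_zero_right, Ring.choose_one_right, hs, List.ofFn_const,
    List.prod_replicate, smul_eq_mul, zero_add, Real.norm_eq_abs, abs_pow, abs_neg,
    abs_abs] at h1 h2
  have e4 : |t| ^ 4 = t ^ 4 := by rw [← abs_pow, abs_of_nonneg (by positivity)]
  rw [e4] at h1 h2
  have h1' := (abs_le.1 h1).2
  have h2' := (abs_le.1 h2).2
  rw [← sub_eq_add_neg] at h2'
  nlinarith

/-- The radially decreasing function `x ↦ (|x|² + b) ^ (-a)` on the lattice. -/
noncomputable def potential {d : ℕ} (b a : ℝ) (x : Fin d → ℤ) : ℝ :=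
  (∑ i, (x i : ℝ) ^ 2 + b) ^ (-a)

lemma sum_sq_add_smul_single {d : ℕ} (x : Fin d → ℤ) (i : Fin d) (c : ℤ) :
    ∑ j, (((x + c • Pi.single i 1 : Fin d → ℤ) j : ℤ) : ℝ) ^ 2
      = ∑ j, (x j : ℝ) ^ 2 + 2 * c * x i + (c : ℝ) ^ 2 := by
  have : ∀ j, (((x + c • Pi.single i 1 : Fin d → ℤ) j : ℤ) : ℝ) ^ 2
      = (x j : ℝ) ^ 2 + if j = i then 2 * c * (x i : ℝ) + (c : ℝ) ^ 2 else 0 := by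
    intro j
    by_cases h : j = i
    · subst h; simp; ring
    · simp [h]
  simp_rw [this, Finset.sum_add_distrib, Finset.sum_ite_eq' Finset.univ i]
  simp; ring

lemma one_add_div_le_rpow {a q : ℝ} (ha : 0 ≤ a) (hq : 1 < q) :
    1 + a / q ≤ (1 - 1 / q) ^ (-a) := by
  have h0 : 0 < 1 - 1 / q := by
    rw [sub_pos, div_lt_one (by linarith)]; exact hq
  rw [Real.rpow_def_of_pos h0]
  have hl := Real.log_le_sub_one_of_pos h0
  have he := Real.add_one_le_exp (Real.log (1 - 1 / q) * -a)
  have : a / q = a * (1 / q) := by ring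
  nlinarith

/-- For large `b`, the function `x ↦ (|x|² + b) ^ (-(d - 2) / 2)` is strictly superharmonic
on the whole lattice. -/
lemma exists_potential_superharmonic (d : ℕ) (hd : 3 ≤ d) :
    ∃ b : ℝ, 0 < b ∧ ∀ x : Fin d → ℤ,
      ∑ i, (potential b (((d : ℝ) - 2) / 2) (x + Pi.single i 1)
        + potential b (((d : ℝ) - 2) / 2) (x - Pi.single i 1))
        < 2 * d * potential b (((d : ℝ) - 2) / 2) x := by
  set a : ℝ := ((d : ℝ) - 2) / 2 with ha_def
  have hd' : (3 : ℝ) ≤ d := by exact_mod_cast hd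
  have ha : 0 < a := by rw [ha_def]; linarith
  obtain ⟨K, ε, hK, hε, hT⟩ := exists_rpow_add_rpow_le a
  -- The first summand brings every `t = 2 x_i / q` below `ε`; the second lets the gain from `b`
  -- absorb the quartic remainder.
  refine ⟨4 / ε ^ 2 + 8 * K / (d * a), by positivity, fun x => ?_⟩
  set b : ℝ := 4 / ε ^ 2 + 8 * K / (d * a) with hb_def
  have hb1 : 4 / ε ^ 2 ≤ b := by
    have : 0 ≤ 8 * K / (d * a) := by positivity
    linarith
  have hb2 : 8 * K ≤ d * a * b := by
    have h1 : 8 * K / (d * a) ≤ b := by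
      rw [hb_def]; have : 0 ≤ 4 / ε ^ 2 := by positivity
      linarith
    rw [div_le_iff₀ (by positivity)] at h1
    linarith
  have hb : 0 < b := lt_of_lt_of_le (by positivity) hb1
  set N : ℝ := ∑ j, (x j : ℝ) ^ 2 with hN_def
  have hN : 0 ≤ N := Finset.sum_nonneg fun i _ => sq_nonneg _
  -- With this centre, `|x ± e_i|² + b = q ± 2 x_i` and `|x|² + b = q - 1`.
  set q : ℝ := N + b + 1 with hq_def
  have hq : 1 < q := by linarith
  have hq0 : 0 < q := by linarith
  have hxi : ∀ i, (x i : ℝ) ^ 2 ≤ N := fun i =>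
    Finset.single_le_sum (f := fun j => (x j : ℝ) ^ 2) (fun j _ => sq_nonneg _) (Finset.mem_univ i)
  have hti : ∀ i, |2 * (x i : ℝ) / q| < ε := by
    intro i
    apply abs_lt_of_sq_lt_sq _ hε.le
    rw [div_pow, div_lt_iff₀ (by positivity)]
    have h4 : 4 ≤ ε ^ 2 * b := by
      rw [div_le_iff₀ (by positivity)] at hb1; linarith
    have := hxi i
    have h5 : ε ^ 2 * b ≤ ε ^ 2 * q := by gcongr; linarith
    nlinarith
  have ht1 : ∀ i, |2 * (x i : ℝ) / q| ≤ 1 := by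
    intro i
    apply abs_le_of_sq_le_sq _ zero_le_one
    rw [div_pow, div_le_iff₀ (by positivity)]
    have := hxi i
    nlinarith [sq_nonneg (N - 1)]
  have hterm : ∀ i, potential b a (x + Pi.single i 1) + potential b a (x - Pi.single i 1)
      ≤ q ^ (-a) * (2 + a * (a + 1) * (4 * (x i : ℝ) ^ 2 / q ^ 2)
        + K * (16 * (x i : ℝ) ^ 2 / q ^ 3)) := by
    intro i
    have e1 : potential b a (x + Pi.single i 1) = q ^ (-a) * (1 + 2 * (x i : ℝ) / q) ^ (-a) := by
      have := sum_sq_add_smul_single x i 1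
      rw [one_smul] at this
      rw [potential, this, ← Real.mul_rpow hq0.le]
      · congr 1; field_simp; push_cast; ring
      · linarith [(abs_le.1 (ht1 i)).1]
    have e2 : potential b a (x - Pi.single i 1) = q ^ (-a) * (1 - 2 * (x i : ℝ) / q) ^ (-a) := by
      have := sum_sq_add_smul_single x i (-1)
      rw [neg_one_smul, ← sub_eq_add_neg] at this
      rw [potential, this, ← Real.mul_rpow hq0.le]
      · congr 1; field_simp; push_cast; ring
      · linarith [(abs_le.1 (ht1 i)).2]
    rw [e1, e2, ← mul_add]
    refine mul_le_mul_of_nonneg_left ((hT _ (hti i)).trans ?_) (by positivity)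
    have h2 : (2 * (x i : ℝ) / q) ^ 2 = 4 * (x i : ℝ) ^ 2 / q ^ 2 := by
      field_simp; ring
    have h4 : (2 * (x i : ℝ) / q) ^ 4 ≤ 16 * (x i : ℝ) ^ 2 / q ^ 3 := by
      have : (2 * (x i : ℝ) / q) ^ 4 = 16 * (x i : ℝ) ^ 2 * (x i : ℝ) ^ 2 / q ^ 4 := by
        field_simp; ring
      rw [this, div_le_div_iff₀ (by positivity) (by positivity)]
      have h := hxi i
      have : (x i : ℝ) ^ 2 ≤ q := by linarith
      calc 16 * (x i : ℝ) ^ 2 * (x i : ℝ) ^ 2 * q ^ 3 ≤ 16 * (x i : ℝ) ^ 2 * q * q ^ 3 := by gcongr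
        _ = _ := by ring
    rw [h2]
    gcongr
  refine (Finset.sum_le_sum fun i _ => hterm i).trans_lt ?_
  have hsum : ∑ i : Fin d, q ^ (-a) * (2 + a * (a + 1) * (4 * (x i : ℝ) ^ 2 / q ^ 2)
      + K * (16 * (x i : ℝ) ^ 2 / q ^ 3))
      = q ^ (-a) * (2 * d + a * (a + 1) * (4 * N / q ^ 2) + K * (16 * N / q ^ 3)) := by
    rw [← Finset.mul_sum, Finset.sum_add_distrib, Finset.sum_add_distrib, ← Finset.mul_sum,
      ← Finset.mul_sum, ← Finset.sum_div, ← Finset.sum_div, ← Finset.mul_sum, ← Finset.mul_sum]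
    rw [← hN_def]
    simp only [Finset.sum_const, Finset.card_univ, Fintype.card_fin, nsmul_eq_mul]
    ring
  have e0 : potential b a x = q ^ (-a) * (1 - 1 / q) ^ (-a) := by
    rw [potential, ← Real.mul_rpow hq0.le]
    · congr 1; field_simp; ring
    · rw [sub_nonneg, div_le_one hq0]; exact hq.le
  rw [hsum, e0]
  have hqa : 0 < q ^ (-a) := by positivity
  have hbern := one_add_div_le_rpow ha.le hq
  have hmain : 2 * d + a * (a + 1) * (4 * N / q ^ 2) + K * (16 * N / q ^ 3)
      < 2 * d * (1 + a / q) := by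
    -- Here the exponent matters: `2 * (a + 1) = d`, so the leading terms cancel up to a gain of
    -- order `(b + 1) / q ^ 2`.
    have h1 : a * (a + 1) * (4 * N / q ^ 2) = 2 * d * (a * N / q ^ 2) := by
      rw [ha_def]; ring
    have h2 : K * (16 * N / q ^ 3) ≤ 16 * K / q ^ 2 := by
      rw [mul_div_assoc', div_le_div_iff₀ (by positivity) (by positivity)]
      have : N ≤ q := by linarith
      calc K * (16 * N) * q ^ 2 ≤ K * (16 * q) * q ^ 2 := by gcongr
        _ = _ := by ring
    have h3 : 2 * d * (a / q) - 2 * d * (a * N / q ^ 2) = 2 * d * a * (b + 1) / q ^ 2 := by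
      field_simp; ring
    have h4 : 16 * K / q ^ 2 < 2 * d * a * (b + 1) / q ^ 2 := by
      have : 0 < d * a := by positivity
      apply div_lt_div_of_pos_right _ (by positivity)
      nlinarith
    linarith
  calc _ < q ^ (-a) * (2 * d * (1 + a / q)) := by gcongr
    _ ≤ q ^ (-a) * (2 * d * (1 - 1 / q) ^ (-a)) := by gcongr
    _ = _ := by ring


/-! ### The walk killed outside a set -/

/-- The event that the walk `Y` is at `x` at time `n` and has stayed in `B` strictly before. -/
def stayThenAt {Ω α : Type*} (Y : ℕ → Ω → α) (B : Set α) (n : ℕ) (x : α) : Set Ω :=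
  {ω | Y n ω = x ∧ ∀ j < n, Y j ω ∈ B}

section walk

variable {Ω : Type*} [MeasurableSpace Ω] {μ : Measure Ω} {d : ℕ}
  {Y : ℕ → Ω → (Fin d → ℤ)} {v : Fin d → ℤ}

lemma measurableSet_step (hY : IsSimpleRandomWalk μ v Y) (n : ℕ) (e : Fin d → ℤ) :
    MeasurableSet {ω | Y (n + 1) ω - Y n ω = e} :=
  ((hY.measurable (n + 1)).sub (hY.measurable n)) (measurableSet_singleton e)

/-- The past of the walk is independent of its next step. -/
lemma measure_stayThenAt_inter_step (hY : IsSimpleRandomWalk μ v Y) (B : Set (Fin d → ℤ))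
    (n : ℕ) (x e : Fin d → ℤ) :
    μ (stayThenAt Y B n x ∩ {ω | Y (n + 1) ω - Y n ω = e})
      = μ (stayThenAt Y B n x) * μ {ω | Y (n + 1) ω - Y n ω = e} := by
  set ξ : ℕ → Ω → (Fin d → ℤ) := fun n ω => Y (n + 1) ω - Y n ω with hξ
  have hmeas : ∀ i, Measurable (ξ i) := fun i => (hY.measurable (i + 1)).sub (hY.measurable i)
  have hind := hY.indep.indepFun_finset (Finset.range n) {n} (by simp) hmeas
  -- `path` rebuilds the walk from its first `n` increments, so the past event is almost surely
  -- determined by them.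
  let path : (Finset.range n → (Fin d → ℤ)) → ℕ → (Fin d → ℤ) :=
    fun w j => v + ∑ k : Finset.range n, if (k : ℕ) < j then w k else 0
  let S : Set (Finset.range n → (Fin d → ℤ)) := {w | path w n = x ∧ ∀ j < n, path w j ∈ B}
  let T : Set (({n} : Finset ℕ) → (Fin d → ℤ)) := {w | w ⟨n, Finset.mem_singleton_self n⟩ = e}
  have hpath : ∀ ω, Y 0 ω = v → ∀ j ≤ n, path (fun k => ξ k ω) j = Y j ω := by
    intro ω h0 j hj
    have h1 : ∑ k : Finset.range n, (if (k : ℕ) < j then ξ k ω else 0)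
        = ∑ k ∈ Finset.range n, if k < j then ξ k ω else 0 :=
      Finset.sum_coe_sort (Finset.range n) (fun k => if k < j then ξ k ω else 0)
    have h2 : (Finset.range n).filter (· < j) = Finset.range j := by
      ext k; simp; omega
    simp only [path]
    rw [h1, ← Finset.sum_filter, h2, hξ, Finset.sum_range_sub (fun k => Y k ω), h0]
    abel
  have hS : MeasurableSet S := S.to_countable.measurableSet
  have hT : MeasurableSet T := T.to_countable.measurableSet
  have key := hind.measure_inter_preimage_eq_mul S T hS hT
  have hEq : stayThenAt Y B n x =ᵐ[μ] (fun ω (k : Finset.range n) => ξ k ω) ⁻¹' S := by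
    filter_upwards [hY.start] with ω h0
    apply propext
    change (Y n ω = x ∧ ∀ j < n, Y j ω ∈ B) ↔
      (path (fun k => ξ k ω) n = x ∧ ∀ j < n, path (fun k => ξ k ω) j ∈ B)
    rw [hpath ω h0 n le_rfl]
    refine and_congr_right fun _ => forall₂_congr fun j hj => ?_
    rw [hpath ω h0 j hj.le]
  have hinter : (stayThenAt Y B n x ∩ {ω | Y (n + 1) ω - Y n ω = e} : Set Ω)
      =ᵐ[μ] ((fun ω (k : Finset.range n) => ξ k ω) ⁻¹' S ∩ {ω | ξ n ω = e} : Set Ω) :=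
    hEq.inter (ae_eq_refl _)
  rw [measure_congr hEq, measure_congr hinter]
  exact key

variable [IsProbabilityMeasure μ]

/-- Almost surely every step is one of the vectors `± e_i`. -/
lemma ae_step (hd : 0 < d) (hY : IsSimpleRandomWalk μ v Y) (n : ℕ) :
    ∀ᵐ ω ∂μ, ∃ i : Fin d, Y (n + 1) ω - Y n ω = Pi.single i 1 ∨
      Y (n + 1) ω - Y n ω = -Pi.single i 1 := by
  let e : Fin d × Bool → (Fin d → ℤ) := fun p => if p.2 then Pi.single p.1 1 else -Pi.single p.1 1
  have he : Function.Injective e := by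
    rintro ⟨i, s⟩ ⟨j, t⟩ h
    have hi := congrFun h i
    have hij : i = j := by
      by_contra hij
      cases s <;> cases t <;> simp [e, hij] at hi
    subst hij
    cases s <;> cases t <;> first | rfl | (norm_num [e] at hi)
  let A : Fin d × Bool → Set Ω := fun p => {ω | Y (n + 1) ω - Y n ω = e p}
  have hA : ∀ p, MeasurableSet (A p) := fun p => measurableSet_step hY n _
  have hdisj : Pairwise (Function.onFun Disjoint A) := by
    intro p q hpq
    refine Set.disjoint_left.2 fun ω hp hq => hpq (he ?_)
    exact (hp : _ = _).symm.trans hq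
  have hone : μ.real (⋃ p, A p) = 1 := by
    rw [measureReal_iUnion_fintype hdisj hA, Fintype.sum_prod_type]
    have : ∀ i : Fin d, ∑ s : Bool, μ.real (A (i, s)) = 1 / d := by
      intro i
      rw [Fintype.sum_bool]
      have h1 := hY.step_pos n i
      have h2 := hY.step_neg n i
      simp only [A, e]
      simp only [if_true, Bool.false_eq_true, if_false]
      rw [h1, h2]
      field_simp; ring
    simp only [this, Finset.sum_const, Finset.card_univ, Fintype.card_fin, nsmul_eq_mul]
    have : (d : ℝ) ≠ 0 := by positivity
    field_simp
  have hae : ∀ᵐ ω ∂μ, ω ∈ ⋃ p, A p := by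
    refine (mem_ae_iff_prob_eq_one (MeasurableSet.iUnion hA)).2 ?_
    rw [← ofReal_measureReal, hone, ENNReal.ofReal_one]
  filter_upwards [hae] with ω hω
  obtain ⟨⟨i, s⟩, h⟩ := Set.mem_iUnion.1 hω
  refine ⟨i, ?_⟩
  cases s
  · right; simpa [A, e] using h
  · left; simpa [A, e] using h

lemma measureReal_stayThenAt_zero (hY : IsSimpleRandomWalk μ v Y) (B : Set (Fin d → ℤ))
    (x : Fin d → ℤ) : μ.real (stayThenAt Y B 0 x) ≤ if x = v then 1 else 0 := by
  split_ifs with h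
  · exact measureReal_le_one
  · refine le_of_eq ?_
    rw [measureReal_def, ENNReal.toReal_eq_zero_iff]
    left
    rw [← compl_compl (stayThenAt Y B 0 x)]
    refine mem_ae_iff.1 ?_
    filter_upwards [hY.start] with ω h0 hω
    exact h (hω.1.symm.trans h0)

open Classical in
/-- The one-step recursion for the law of the walk killed outside `B`. -/
lemma measureReal_stayThenAt_succ (hd : 0 < d) (hY : IsSimpleRandomWalk μ v Y)
    (B : Set (Fin d → ℤ)) (n : ℕ) (x : Fin d → ℤ) :
    μ.real (stayThenAt Y B (n + 1) x) ≤ (2 * d : ℝ)⁻¹ * ∑ i : Fin d,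
      ((if x + Pi.single i 1 ∈ B then μ.real (stayThenAt Y B n (x + Pi.single i 1)) else 0)
      + (if x - Pi.single i 1 ∈ B then μ.real (stayThenAt Y B n (x - Pi.single i 1)) else 0)) := by
  -- Split by the last step: reaching `x` from `x + e_i` takes `-e_i`, and from `x - e_i` takes
  -- `e_i`.
  let P : Fin d → Set Ω := fun i => if x + Pi.single i 1 ∈ B then
    stayThenAt Y B n (x + Pi.single i 1) ∩ {ω | Y (n + 1) ω - Y n ω = -Pi.single i 1} else ∅
  let Q : Fin d → Set Ω := fun i => if x - Pi.single i 1 ∈ B then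
    stayThenAt Y B n (x - Pi.single i 1) ∩ {ω | Y (n + 1) ω - Y n ω = Pi.single i 1} else ∅
  have hsub : stayThenAt Y B (n + 1) x ≤ᵐ[μ] (⋃ i, (P i ∪ Q i) : Set Ω) := by
    filter_upwards [ae_step hd hY n] with ω hω hx
    obtain ⟨hx1, hx2⟩ := hx
    obtain ⟨i, h | h⟩ := hω
    · have hn : Y n ω = x - Pi.single i 1 := by rw [← hx1, ← h]; abel
      have hB := hx2 n n.lt_succ_self
      rw [hn] at hB
      refine Set.mem_iUnion.2 ⟨i, Or.inr ?_⟩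
      simp only [Q, if_pos hB]
      exact ⟨⟨hn, fun j hj => hx2 j (by omega)⟩, h⟩
    · have hn : Y n ω = x + Pi.single i 1 := by
        rw [← hx1, ← neg_eq_iff_eq_neg.2 h]; abel
      have hB := hx2 n n.lt_succ_self
      rw [hn] at hB
      refine Set.mem_iUnion.2 ⟨i, Or.inl ?_⟩
      simp only [P, if_pos hB]
      exact ⟨⟨hn, fun j hj => hx2 j (by omega)⟩, h⟩
  have h1 : μ.real (stayThenAt Y B (n + 1) x) ≤ μ.real (⋃ i, (P i ∪ Q i)) :=
    ENNReal.toReal_mono (measure_ne_top _ _) (measure_mono_ae hsub)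
  refine h1.trans ((measureReal_iUnion_fintype_le _).trans ?_)
  rw [Finset.mul_sum]
  refine Finset.sum_le_sum fun i _ => (measureReal_union_le _ _).trans ?_
  rw [mul_add]
  refine add_le_add ?_ ?_
  · simp only [P]
    split_ifs
    · rw [measureReal_def, measure_stayThenAt_inter_step hY, ENNReal.toReal_mul,
        ← measureReal_def, ← measureReal_def, hY.step_neg n i, mul_comm, one_div]
    · simp
  · simp only [Q]
    split_ifs
    · rw [measureReal_def, measure_stayThenAt_inter_step hY, ENNReal.toReal_mul,
        ← measureReal_def, ← measureReal_def, hY.step_pos n i, mul_comm, one_div]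
    · simp

end walk

/-- A union bound over the points of a finite target and over the hitting times. -/
lemma measureReal_hitsBefore_le {Ω α : Type*} [MeasurableSpace Ω] (μ : Measure Ω)
    [IsProbabilityMeasure μ] (Y : ℕ → Ω → α) (A : Finset α) (B : Set α) (M : ℝ) (hM : 0 ≤ M)
    (h : ∀ x ∈ A, ∀ N : ℕ, ∑ n ∈ Finset.range N, μ.real (stayThenAt Y B n x) ≤ M) :
    μ.real {ω | HitsBefore (fun n => Y n ω) (A : Set α) Bᶜ} ≤ A.card * M := by
  have hsub : {ω | HitsBefore (fun n => Y n ω) (A : Set α) Bᶜ}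
      ⊆ ⋃ x ∈ A, ⋃ n, stayThenAt Y B n x := by
    rintro ω ⟨k, hk, hj⟩
    simp only [Set.mem_iUnion]
    exact ⟨Y k ω, hk, k, rfl, fun j hjk => not_not.1 (hj j hjk)⟩
  have hbound : μ {ω | HitsBefore (fun n => Y n ω) (A : Set α) Bᶜ}
      ≤ ENNReal.ofReal (A.card * M) := by
    refine (measure_mono hsub).trans ((measure_biUnion_finset_le _ _).trans ?_)
    have : ∀ x ∈ A, μ (⋃ n, stayThenAt Y B n x) ≤ ENNReal.ofReal M := by
      intro x hx
      refine (measure_iUnion_le _).trans (ENNReal.tsum_le_of_sum_range_le fun N => ?_)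
      calc ∑ n ∈ Finset.range N, μ (stayThenAt Y B n x)
          = ENNReal.ofReal (∑ n ∈ Finset.range N, μ.real (stayThenAt Y B n x)) := by
            rw [ENNReal.ofReal_sum_of_nonneg fun _ _ => measureReal_nonneg]
            simp
        _ ≤ ENNReal.ofReal M := ENNReal.ofReal_le_ofReal (h x hx N)
    refine (Finset.sum_le_sum this).trans (le_of_eq ?_)
    rw [Finset.sum_const, nsmul_eq_mul, ENNReal.ofReal_mul (by positivity), ENNReal.ofReal_natCast]
  exact ENNReal.toReal_le_of_le_ofReal (by positivity) hbound


/-! ### Comparison of the killed Green function with a superharmonic function -/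

open Classical in
/-- Comparison of a killed Green function with a superharmonic function `F`: the partial sums of
a sequence `p` that obeys the one-step recursion of a walk killed outside `B` are bounded by a
multiple of `F - m`, where `m` is a lower bound for `F` near the domain `D ⊇ B`. -/
lemma sum_le_of_superharmonic {d : ℕ} (hd : 0 < d) {B D : Set (Fin d → ℤ)} (hBD : B ⊆ D)
    {p : ℕ → (Fin d → ℤ) → ℝ} {F : (Fin d → ℤ) → ℝ} {A m : ℝ} (hA : 0 ≤ A)
    (hp0 : ∀ x, p 0 x ≤ if x = 0 then 1 else 0)
    (hp : ∀ n x, p (n + 1) x ≤ (2 * d : ℝ)⁻¹ * ∑ i : Fin d,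
      ((if x + Pi.single i 1 ∈ B then p n (x + Pi.single i 1) else 0)
      + (if x - Pi.single i 1 ∈ B then p n (x - Pi.single i 1) else 0)))
    (hF : ∀ x, ∑ i, (F (x + Pi.single i 1) + F (x - Pi.single i 1)) ≤ 2 * d * F x)
    (hF0 : 2 * d ≤ A * (2 * d * F 0 - ∑ i, (F (0 + Pi.single i 1) + F (0 - Pi.single i 1))))
    (hm : ∀ x ∈ D, m ≤ F x)
    (hm' : ∀ x ∈ D, ∀ i, m ≤ F (x + Pi.single i 1) ∧ m ≤ F (x - Pi.single i 1)) (N : ℕ) :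
    ∀ x ∈ D, ∑ n ∈ Finset.range N, p n x ≤ A * (F x - m) := by
  have hd' : (0 : ℝ) < 2 * d := by positivity
  induction N with
  | zero =>
    intro x hx
    simpa using mul_nonneg hA (sub_nonneg.2 (hm x hx))
  | succ N ih =>
    intro x hx
    -- A neighbour outside `B` contributes zero, so there only `F y ≥ m` is needed.
    have hle : ∀ y, m ≤ F y →
        ∑ n ∈ Finset.range N, (if y ∈ B then p n y else 0) ≤ A * (F y - m) := by
      intro y hy
      split_ifs with hyB
      · exact ih y (hBD hyB)
      · simpa using mul_nonneg hA (sub_nonneg.2 hy)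
    have h1 : ∑ n ∈ Finset.range N, p (n + 1) x
        ≤ (2 * d : ℝ)⁻¹ * ∑ i : Fin d,
          (A * (F (x + Pi.single i 1) - m) + A * (F (x - Pi.single i 1) - m)) := by
      refine (Finset.sum_le_sum fun n _ => hp n x).trans ?_
      rw [← Finset.mul_sum, Finset.sum_comm]
      refine mul_le_mul_of_nonneg_left (Finset.sum_le_sum fun i _ => ?_) (by positivity)
      rw [Finset.sum_add_distrib]
      exact add_le_add (hle _ (hm' x hx i).1) (hle _ (hm' x hx i).2)
    have h2 : ∑ i : Fin d, (A * (F (x + Pi.single i 1) - m) + A * (F (x - Pi.single i 1) - m))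
        = A * (∑ i, (F (x + Pi.single i 1) + F (x - Pi.single i 1)) - 2 * d * m) := by
      have : ∀ i : Fin d, A * (F (x + Pi.single i 1) - m) + A * (F (x - Pi.single i 1) - m)
          = A * ((F (x + Pi.single i 1) + F (x - Pi.single i 1)) - 2 * m) := fun i => by ring
      simp_rw [this]
      rw [← Finset.mul_sum, Finset.sum_sub_distrib]
      simp; ring_nf; simp
    rw [h2] at h1
    -- Peel off time `0`: its mass sits at the origin, where the superharmonic gap in `hF0` pays for
    -- it.
    rw [Finset.sum_range_succ']
    have h3 := hp0 x
    suffices h : A * (∑ i, (F (x + Pi.single i 1) + F (x - Pi.single i 1)) - 2 * d * m)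
        ≤ 2 * d * (A * (F x - m) - if x = 0 then 1 else 0) by
      have := mul_le_mul_of_nonneg_left h (inv_nonneg.2 hd'.le)
      rw [inv_mul_cancel_left₀ hd'.ne'] at this
      linarith
    split_ifs with hx0
    · subst hx0
      linarith
    · have := mul_le_mul_of_nonneg_left (hF x) hA
      linarith

/-- The tangent line bound for `s ↦ s ^ (-a)`. -/
lemma rpow_neg_sub_rpow_neg_le {a s u : ℝ} (ha : 0 ≤ a) (hs : 0 < s) (hu : 0 < u) :
    s ^ (-a) - u ^ (-a) ≤ a * s ^ (-(a + 1)) * (u - s) := by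
  have hus : 0 < u / s := by positivity
  have h1 : u ^ (-a) = s ^ (-a) * (u / s) ^ (-a) := by
    rw [← Real.mul_rpow hs.le hus.le]; congr 1; field_simp
  have h2 : s ^ (-(a + 1)) = s ^ (-a) / s := by
    rw [neg_add, ← sub_eq_add_neg, Real.rpow_sub_one hs.ne']
  have h3 : 1 - a * (u / s - 1) ≤ (u / s) ^ (-a) := by
    rw [Real.rpow_def_of_pos hus]
    have hl := Real.log_le_sub_one_of_pos hus
    have he := Real.add_one_le_exp (Real.log (u / s) * -a)
    nlinarith
  rw [h1, h2]
  have h4 : a * (s ^ (-a) / s) * (u - s) = s ^ (-a) * (a * (u / s - 1)) := by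
    field_simp
  rw [h4]
  have h5 : 0 < s ^ (-a) := by positivity
  nlinarith

/-! ### Counting the lattice points of a cell -/

lemma norm_toEuclid_sq {d : ℕ} (x : Fin d → ℤ) :
    ‖toEuclid x‖ ^ 2 = ∑ i, (x i : ℝ) ^ 2 := by
  simp [EuclideanSpace.norm_sq_eq, toEuclid]

/-- The lattice points of the cube with centre `z` and half side length `w`. -/
noncomputable def latticeBox {d : ℕ} (z : Fin d → ℝ) (w : ℝ) : Finset (Fin d → ℤ) :=
  Fintype.piFinset fun i => Finset.Icc ⌈z i - w⌉ ⌊z i + w⌋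

lemma mem_latticeBox {d : ℕ} {z : Fin d → ℝ} {w : ℝ} {x : Fin d → ℤ} :
    x ∈ latticeBox z w ↔ ∀ i, |(x i : ℝ) - z i| ≤ w := by
  simp only [latticeBox, Fintype.mem_piFinset, Finset.mem_Icc, Int.ceil_le, Int.le_floor]
  refine forall_congr' fun i => ?_
  rw [abs_le]
  constructor <;> rintro ⟨h1, h2⟩ <;> constructor <;> linarith

lemma card_latticeBox_le {d : ℕ} (z : Fin d → ℝ) {w : ℝ} (hw : 0 ≤ w) :
    ((latticeBox z w).card : ℝ) ≤ (2 * w + 1) ^ d := by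
  rw [latticeBox, Fintype.card_piFinset, Nat.cast_prod]
  refine (Finset.prod_le_prod (fun _ _ => Nat.cast_nonneg _) (g := fun _ => 2 * w + 1) ?_).trans
    (by simp)
  intro i _
  rw [Int.card_Icc]
  have h : (((⌊z i + w⌋ + 1 - ⌈z i - w⌉).toNat : ℕ) : ℝ)
      = ((max (⌊z i + w⌋ + 1 - ⌈z i - w⌉) 0 : ℤ) : ℝ) := by
    rw [← Int.toNat_eq_max, Int.cast_natCast]
  rw [h]
  push_cast
  refine max_le ?_ (by linarith)
  linarith [Int.floor_le (z i + w), Int.le_ceil (z i - w)]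

/-- A cell of angular width `c / R` and thickness `L ≤ δ R` has `O(L + 1)` lattice points. -/
lemma exists_finset_eq_lattice_cell {d : ℕ} {R L δ c : ℝ} (hR : 0 < R) (hc : 0 ≤ c) (hδ : 0 ≤ δ)
    (hL : 0 ≤ L) (hLR : L ≤ δ * R) {T : Set (EuclideanSpace ℝ (Fin d))}
    (hT : T ⊆ Metric.sphere 0 1) (hdiam : ∀ x ∈ T, ∀ y ∈ T, ‖x - y‖ ≤ c / R) :
    ∃ A : Finset (Fin d → ℤ), (A : Set (Fin d → ℤ)) = lattice (cell (annulus d (R + L) R) T) ∧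
      (A.card : ℝ) ≤ (L + 1) * (2 * (c * (1 + δ) + 1) + 1) ^ d := by
  classical
  rcases T.eq_empty_or_nonempty with rfl | ⟨t, ht⟩
  · refine ⟨∅, ?_, ?_⟩
    · ext x; simp [lattice, cell, cone]
    · simp only [Finset.card_empty, Nat.cast_zero]; positivity
  set w : ℝ := c * (1 + δ) + 1 with hw
  have hw0 : 0 ≤ w := by positivity
  -- Cover the cell by boxes of fixed size centred at unit spacing along the ray through `t`.
  let U : Finset (Fin d → ℤ) := (Finset.range (⌊L⌋₊ + 1)).biUnion
    fun k => latticeBox (fun i => ((R + k) • t) i) w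
  have hsub : ∀ x ∈ lattice (cell (annulus d (R + L) R) T), x ∈ U := by
    rintro x ⟨⟨hx1, hx2⟩, hx3⟩
    set y := toEuclid x with hy
    have hr1 : ‖y‖ ≤ R + L := by simpa using hx1
    have hr2 : R ≤ ‖y‖ := by simpa using hx2
    have hx3 : ‖y‖⁻¹ • y ∈ T := hx3
    have hr0 : 0 < ‖y‖ := hR.trans_le hr2
    set k := ⌊‖y‖ - R⌋₊ with hk
    have hk1 : (k : ℝ) ≤ ‖y‖ - R := Nat.floor_le (by linarith)
    have hk2 : ‖y‖ - R < k + 1 := Nat.lt_floor_add_one _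
    refine Finset.mem_biUnion.2 ⟨k, ?_, mem_latticeBox.2 fun i => ?_⟩
    · rw [Finset.mem_range, Nat.lt_succ_iff]
      exact Nat.floor_mono (by linarith)
    · have hdec : y - (R + k) • t = ‖y‖ • (‖y‖⁻¹ • y - t) + (‖y‖ - R - k) • t := by
        rw [smul_sub, smul_smul, mul_inv_cancel₀ hr0.ne', one_smul]
        module
      have ht1 : ‖t‖ = 1 := by simpa using hT ht
      have hn : ‖y - (R + k) • t‖ ≤ w := by
        rw [hdec]
        refine (norm_add_le _ _).trans ?_
        rw [norm_smul, norm_smul, ht1, mul_one, Real.norm_eq_abs, Real.norm_eq_abs,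
          abs_of_pos hr0, abs_of_nonneg (by linarith), hw]
        refine add_le_add ?_ (by linarith)
        calc ‖y‖ * ‖‖y‖⁻¹ • y - t‖ ≤ ((1 + δ) * R) * (c / R) := by
              gcongr
              · linarith
              · exact hdiam _ hx3 _ ht
          _ = c * (1 + δ) := by field_simp
      refine le_trans ?_ hn
      have := PiLp.norm_apply_le (y - (R + k) • t) i
      rw [Real.norm_eq_abs] at this
      exact this
  refine ⟨U.filter (· ∈ lattice (cell (annulus d (R + L) R) T)), ?_, ?_⟩
  · ext x
    simp only [Finset.coe_filter, Set.mem_ofPred_eq]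
    exact ⟨fun h => h.2, fun h => ⟨hsub x h, h⟩⟩
  · calc ((U.filter (· ∈ lattice (cell (annulus d (R + L) R) T))).card : ℝ) ≤ U.card := by
          exact_mod_cast Finset.card_filter_le _ _
      _ ≤ ∑ k ∈ Finset.range (⌊L⌋₊ + 1),
            ((latticeBox (fun i => ((R + (k : ℕ)) • t) i) w).card : ℝ) := by
          exact_mod_cast Finset.card_biUnion_le
      _ ≤ ∑ k ∈ Finset.range (⌊L⌋₊ + 1), (2 * w + 1) ^ d :=
          Finset.sum_le_sum fun k _ => card_latticeBox_le _ hw0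
      _ = (⌊L⌋₊ + 1) * (2 * w + 1) ^ d := by simp
      _ ≤ (L + 1) * (2 * w + 1) ^ d := by
          gcongr
          exact Nat.floor_le hL

/-! ### The Green function bound in a ball -/

/-- The expected time that the walk from the origin, killed outside a ball of radius `ρ`, spends
at a point `x` of norm between `R` and `ρ`. -/
lemma exists_sum_stayThenAt_le (d : ℕ) (hd : 3 ≤ d) :
    ∃ A : ℝ, 0 ≤ A ∧ ∀ {Ω : Type*} [MeasurableSpace Ω] (μ : Measure Ω) [IsProbabilityMeasure μ]
      (Y : ℕ → Ω → (Fin d → ℤ)), IsSimpleRandomWalk μ 0 Y → ∀ R ρ : ℝ, 0 < R → 0 ≤ ρ →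
      ∀ x : Fin d → ℤ, R ≤ ‖toEuclid x‖ → ‖toEuclid x‖ ≤ ρ → ∀ N : ℕ,
        ∑ n ∈ Finset.range N, μ.real (stayThenAt Y (latticeBall d ρ) n x)
          ≤ A * (((ρ + 1) ^ 2 - R ^ 2) / R ^ d) := by
  obtain ⟨b, hb, hF⟩ := exists_potential_superharmonic d hd
  set a : ℝ := ((d : ℝ) - 2) / 2 with ha_def
  have hd' : (3 : ℝ) ≤ d := by exact_mod_cast hd
  have ha : 0 < a := by rw [ha_def]; linarith
  set g : ℝ := 2 * d * potential b a (0 : Fin d → ℤ)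
    - ∑ i : Fin d, (potential b a (0 + Pi.single i 1) + potential b a (0 - Pi.single i 1)) with hg
  have hg0 : 0 < g := sub_pos.2 (hF 0)
  refine ⟨2 * d / g * a, by positivity, ?_⟩
  intro Ω _ μ _ Y hY R ρ hR hρ x hxR hxρ N
  -- One step from the closed ball of radius `ρ` reaches norm at most `ρ + 1`.
  set m : ℝ := ((ρ + 1) ^ 2 + b) ^ (-a) with hm
  have hpot : ∀ y : Fin d → ℤ, ∑ i, (y i : ℝ) ^ 2 ≤ (ρ + 1) ^ 2 → m ≤ potential b a y := by
    intro y hy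
    have h0 : 0 ≤ ∑ i, (y i : ℝ) ^ 2 := Finset.sum_nonneg fun i _ => sq_nonneg _
    exact Real.rpow_le_rpow_of_nonpos (by linarith) (by linarith) (by linarith)
  have hsq : ∀ y : Fin d → ℤ, ‖toEuclid y‖ ≤ ρ → ∑ i, (y i : ℝ) ^ 2 ≤ ρ ^ 2 := by
    intro y hy
    rw [← norm_toEuclid_sq]
    gcongr
  -- `D` is the closed ball, since a target point may lie on the sphere of radius `ρ`, outside the
  -- open killing domain.
  have hmain := sum_le_of_superharmonic (d := d) (by omega) (B := latticeBall d ρ)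
    (D := {y | ‖toEuclid y‖ ≤ ρ}) (p := fun n y => μ.real (stayThenAt Y (latticeBall d ρ) n y))
    (F := potential b a) (A := 2 * d / g) (m := m)
    (fun y hy => by
      have : ‖toEuclid y‖ < ρ := by simpa [latticeBall, lattice] using hy
      exact this.le)
    (by positivity) (measureReal_stayThenAt_zero hY _)
    (measureReal_stayThenAt_succ (by omega) hY _) (fun y => (hF y).le)
    (by rw [← hg, div_mul_cancel₀ _ hg0.ne'])
    (fun y hy => hpot y ((hsq y hy).trans (by gcongr; linarith)))
    (fun y hy i => by
      have hy2 := hsq y hy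
      have hi : (y i : ℝ) ^ 2 ≤ ρ ^ 2 := (Finset.single_le_sum (f := fun j => (y j : ℝ) ^ 2)
        (fun j _ => sq_nonneg _) (Finset.mem_univ i)).trans hy2
      have hi' := abs_le.1 (abs_le_of_sq_le_sq hi hρ)
      have h1 := sum_sq_add_smul_single y i 1
      have h2 := sum_sq_add_smul_single y i (-1)
      rw [one_smul] at h1
      rw [neg_one_smul, ← sub_eq_add_neg] at h2
      push_cast at h1 h2
      constructor
      · apply hpot; rw [h1]; nlinarith [hi'.2]
      · apply hpot; rw [h2]; nlinarith [hi'.1]) N x hxρ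
  refine hmain.trans ?_
  rw [mul_assoc]
  refine mul_le_mul_of_nonneg_left ?_ (by positivity)
  have hN : R ^ 2 ≤ ∑ i, (x i : ℝ) ^ 2 := by
    rw [← norm_toEuclid_sq]; gcongr
  have hN' := hsq x hxρ
  set S : ℝ := ∑ i, (x i : ℝ) ^ 2 with hS
  have hR2 : 0 < R ^ 2 := by positivity
  have hs : 0 < S + b := by linarith
  have ht := rpow_neg_sub_rpow_neg_le (a := a) (s := S + b) (u := (ρ + 1) ^ 2 + b) ha.le hs
    (by positivity)
  have hRd : (S + b) ^ (-(a + 1)) ≤ 1 / R ^ d := by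
    calc (S + b) ^ (-(a + 1)) ≤ (R ^ 2) ^ (-(a + 1)) :=
          Real.rpow_le_rpow_of_nonpos hR2 (by linarith) (by linarith)
      _ = 1 / R ^ d := by
          rw [Real.rpow_neg hR2.le, one_div, ← Real.rpow_natCast R 2, ← Real.rpow_mul hR.le,
            ← Real.rpow_natCast R d]
          congr 2
          rw [ha_def]; push_cast; ring
  calc potential b a x - m ≤ a * (S + b) ^ (-(a + 1)) * ((ρ + 1) ^ 2 + b - (S + b)) := ht
    _ ≤ a * (1 / R ^ d) * ((ρ + 1) ^ 2 - R ^ 2) := by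
        have : 0 ≤ (ρ + 1) ^ 2 + b - (S + b) := by nlinarith
        gcongr ?_ * ?_ * ?_
        linarith
    _ = a * (((ρ + 1) ^ 2 - R ^ 2) / R ^ d) := by ring

end SRWCell

/-! ### The hitting estimate -/

theorem lemma3p4 (d : ℕ) (hd : 3 ≤ d) :
    ∃ R₁ : ℝ, ∀ δ cp : ℝ, 1 < δ → 1 < cp → ∃ C' : ℝ, ∀ R : ℝ, 1 < R → R₁ < R →
      ∀ T : Set (EuclideanSpace ℝ (Fin d)), IsClosed T →
        T ⊆ Metric.sphere (0 : EuclideanSpace ℝ (Fin d)) 1 →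
        (∀ x ∈ T, ∀ y ∈ T, ‖x - y‖ ≤ cp / R) →
      ∀ (Ω : Type*) [MeasurableSpace Ω] (μ : Measure Ω) [IsProbabilityMeasure μ]
        (Y : ℕ → Ω → (Fin d → ℤ)), SRWCell.IsSimpleRandomWalk μ 0 Y →
        μ.real {ω | SRWCell.HitsBefore (fun n => Y n ω)
            (SRWCell.lattice
              (SRWCell.cell (SRWCell.annulus d (R + δ * √(Real.log R)) R) T))
            (SRWCell.latticeBall d (R + δ * √(Real.log R)))ᶜ}
          ≤ C' * (Real.log R / R ^ (d - 1)) := by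
  obtain ⟨A, hA, hgreen⟩ := SRWCell.exists_sum_stayThenAt_le d hd
  -- Since `3 > e`, `log R ≥ 1`, so additive constants are absorbed into `√(log R)`. The constant
  -- `C'` is the point count factor times the Green function factor.
  refine ⟨3, fun δ cp hδ hcp => ⟨(δ + 1) * (2 * (cp * (1 + δ) + 1) + 1) ^ d
    * (A * ((δ + 1) * (3 + δ))), ?_⟩⟩
  intro R hR1 hR3 T _ hT hdiam Ω _ μ _ Y hY
  have hR0 : 0 < R := by linarith
  set l : ℝ := √(Real.log R) with hl
  have hlog1 : 1 ≤ Real.log R := by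
    rw [Real.le_log_iff_exp_le hR0]
    exact (Real.exp_one_lt_d9.le.trans (by norm_num)).trans hR3.le
  have hl1 : 1 ≤ l := Real.one_le_sqrt.2 hlog1
  have hl2 : l ^ 2 = Real.log R := Real.sq_sqrt (by linarith)
  have hlR : l ≤ R := by
    have := Real.log_le_sub_one_of_pos hR0
    nlinarith
  have hδ0 : 0 < δ := by linarith
  obtain ⟨S, hS, hcard⟩ := SRWCell.exists_finset_eq_lattice_cell (L := δ * l) hR0
    (by linarith : 0 ≤ cp) hδ0.le (by positivity) (by gcongr) hT hdiam
  rw [← hS]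
  set ρ : ℝ := R + δ * l with hρ
  have hρ0 : 0 ≤ ρ := by positivity
  have hdiff : (ρ + 1) ^ 2 - R ^ 2 ≤ (δ + 1) * l * ((3 + δ) * R) := by
    have h1 : (ρ + 1) ^ 2 - R ^ 2 = (δ * l + 1) * (2 * R + δ * l + 1) := by rw [hρ]; ring
    have h2 : δ * l ≤ δ * R := by gcongr
    rw [h1]
    gcongr
    · linarith
    · linarith
  have hRd : R ^ d = R ^ (d - 1) * R := by
    rw [← pow_succ]; congr 1; omega
  have hq : ((ρ + 1) ^ 2 - R ^ 2) / R ^ d ≤ (δ + 1) * (3 + δ) * (l / R ^ (d - 1)) := by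
    calc ((ρ + 1) ^ 2 - R ^ 2) / R ^ d ≤ ((δ + 1) * l * ((3 + δ) * R)) / R ^ d := by gcongr
      _ = _ := by rw [hRd]; field_simp
  refine (SRWCell.measureReal_hitsBefore_le μ Y S _
    (A * ((δ + 1) * (3 + δ) * (l / R ^ (d - 1)))) (by positivity) ?_).trans ?_
  · intro x hx N
    have hx' : x ∈ SRWCell.lattice (SRWCell.cell (SRWCell.annulus d ρ R) T) := by
      rw [← hS]; exact hx
    obtain ⟨⟨hx1, hx2⟩, -⟩ := hx'
    refine (hgreen μ Y hY R ρ hR0 hρ0 x (by simpa using hx2) (by simpa using hx1) N).trans ?_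
    gcongr
  · calc (S.card : ℝ) * (A * ((δ + 1) * (3 + δ) * (l / R ^ (d - 1))))
        ≤ ((δ + 1) * l * (2 * (cp * (1 + δ) + 1) + 1) ^ d)
          * (A * ((δ + 1) * (3 + δ) * (l / R ^ (d - 1)))) := by
          gcongr
          refine hcard.trans ?_
          gcongr
          linarith
      _ = _ := by rw [← hl2]; ring
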